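/- Let $\gamma>0$ be fixed and, for $k\in\mathbb N$, let $p=p_k$ and $n_0=n_{0,k},n_1=n_{1,k}$ be integers with $p,n_0,n_1\to\infty$ as $k\to\infty$; the index $k$ is suppressed below and all limits and $O,o$ are for $k\to\infty$. For $i\in\{0,1\}$ let $\mu_i\in\mathbb R^p$, let $\Sigma_i\in\mathbb R^{p\times p}$ be symmetric positive semidefinite, and let $\pi_0,\pi_1>0$ with $\pi_0+\pi_1=1$ be the priors (possibly depending on $k$). On a common probability space, let the training samples $x_{i,1},\dots,x_{i,n_i}$, $i\in\{0,1\}$, be, for each $k$, mutually independent with $x_{i,l}\sim\mathcal N(\mu_i,\Sigma_i)$ (no assumption is made on the joint law for different $k$). Put $$\hat\mu_i=\frac1{n_i}\sum_{l}x_{i,l},\qquad \hat\Sigma_i=\frac1{n_i-1}\sum_l (x_{i,l}-\hat\mu_i)(x_{i,l}-\hat\mu_i)^T,\qquad H_i=(I_p+\gamma\hat\Sigma_i)^{-1},$$ $$\widehat W(x)=\tfrac12\log\frac{|H_0|}{|H_1|}-\tfrac12(x-\hat\mu_0)^TH_0(x-\hat\mu_0)+\tfrac12(x-\hat\mu_1)^TH_1(x-\hat\mu_1)-\log\frac{\pi_1}{\pi_0},$$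 where $|\cdot|$ is the determinant, and let the R-QDA conditional error of class $i$ be $$\varepsilon_i=\mathbb P\big[(-1)^i\widehat W(x)<0\ \big|\ \text{training samples}\big],\qquad x\sim\mathcal N(\mu_i,\Sigma_i)\text{ independent of the training samples.}$$ Put $$B_i=\Sigma_i^{1/2}(H_1-H_0)\Sigma_i^{1/2},\qquad r_i=\Sigma_i^{1/2}\big[H_1(\mu_i-\hat\mu_1)-H_0(\mu_i-\hat\mu_0)\big],$$ $$\xi_i=-\log\frac{|H_0|}{|H_1|}+(\mu_i-\hat\mu_0)^TH_0(\mu_i-\hat\mu_0)-(\mu_i-\hat\mu_1)^TH_1(\mu_i-\hat\mu_1)+2\log\frac{\pi_1}{\pi_0}.$$ Assume that 1. $n_0-n_1=o(1)$ and $p/(n_0+n_1)\to c$ for some $c\in(0,\infty)$; 2. $\|\mu_0-\mu_1\|^2=O(\sqrt p)$ (Euclidean norm); 3. $\|\Sigma_i\|=O(1)$ for $i\in\{0,1\}$ (spectral norm); 4. $\Sigma_0-\Sigma_1$ has $O(\sqrt p)$ eigenvalues (with multiplicity) of order $O(1)$, and its remaining eigenvalues are of order $O(1/\sqrt p)$,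 uniformly; 5. for $i\in\{0,1\}$, almost surely, $2\operatorname{tr}B_i^2+4\|r_i\|^2>0$ for all large $k$ and $$\frac{60\operatorname{tr}B_i^2+240\operatorname{tr}B_i^2\,\|r_i\|^2+48\|r_i\|^4}{\big(2\operatorname{tr}B_i^2+4\|r_i\|^2\big)^2}\longrightarrow0 .$$ Then, for $i\in\{0,1\}$, with $\Phi$ the standard normal distribution function, $$\varepsilon_i-\Phi\left((-1)^i\,\frac{\xi_i-\operatorname{tr}B_i}{\sqrt{2\operatorname{tr}B_i^2+4\|r_i\|^2}}\right)\longrightarrow0\quad\text{almost surely.}$$ -/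

import Mathlib

open MeasureTheory ProbabilityTheory Filter Topology Matrix
open scoped MatrixOrder

namespace RQDA

noncomputable section

/-- The product `A v` of a real matrix and a vector of Euclidean space. -/
def act {p : ℕ} (A : Matrix (Fin p) (Fin p) ℝ) (v : EuclideanSpace ℝ (Fin p)) :
    EuclideanSpace ℝ (Fin p) :=
  Matrix.toEuclideanCLM (𝕜 := ℝ) A v

/-- The quadratic form `vᵀ A v`. -/
def quad {p : ℕ} (A : Matrix (Fin p) (Fin p) ℝ) (v : EuclideanSpace ℝ (Fin p)) : ℝ :=
  inner ℝ v (act A v)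

/-- The spectral norm of a real square matrix. -/
def specNorm {p : ℕ} (A : Matrix (Fin p) (Fin p) ℝ) : ℝ :=
  ‖Matrix.toEuclideanCLM (𝕜 := ℝ) A‖

/-- The sample mean of `x₁, …, xₙ`. -/
def sampleMean {p n : ℕ} (x : Fin n → EuclideanSpace ℝ (Fin p)) : EuclideanSpace ℝ (Fin p) :=
  (1 / (n : ℝ)) • ∑ l, x l

/-- The sample covariance matrix `(n - 1)⁻¹ ∑ (x_l - m) (x_l - m)ᵀ`, `m` the sample mean. -/
def sampleCov {p n : ℕ} (x : Fin n → EuclideanSpace ℝ (Fin p)) : Matrix (Fin p) (Fin p) ℝ :=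
  (1 / ((n : ℝ) - 1)) •
    ∑ l, Matrix.vecMulVec (x l - sampleMean x).ofLp (x l - sampleMean x).ofLp

/-- The ridge estimator `H = (I + γ Σ̂)⁻¹` of the inverse covariance matrix. -/
def ridge {p n : ℕ} (γ : ℝ) (x : Fin n → EuclideanSpace ℝ (Fin p)) :
    Matrix (Fin p) (Fin p) ℝ :=
  (1 + γ • sampleCov x)⁻¹

/-- The R-QDA discriminant at the point `y`, with training samples `x i` of class `i` and priors
`π i`. -/
def discriminant {p : ℕ} {n : Fin 2 → ℕ} (γ : ℝ) (π : Fin 2 → ℝ)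
    (x : (i : Fin 2) → Fin (n i) → EuclideanSpace ℝ (Fin p)) (y : EuclideanSpace ℝ (Fin p)) : ℝ :=
  (1 / 2) * Real.log ((ridge γ (x 0)).det / (ridge γ (x 1)).det)
    - (1 / 2) * quad (ridge γ (x 0)) (y - sampleMean (x 0))
    + (1 / 2) * quad (ridge γ (x 1)) (y - sampleMean (x 1))
    - Real.log (π 1 / π 0)

/-- The R-QDA classification error of class `i` conditional on the training samples `x`: the
probability that a fresh observation `y` of law `N(m i, S i)` satisfies `(-1)^i Ŵ(y) < 0`. -/
def condError {p : ℕ} {n : Fin 2 → ℕ} (γ : ℝ) (π : Fin 2 → ℝ)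
    (m : Fin 2 → EuclideanSpace ℝ (Fin p)) (S : Fin 2 → Matrix (Fin p) (Fin p) ℝ)
    (x : (i : Fin 2) → Fin (n i) → EuclideanSpace ℝ (Fin p)) (i : Fin 2) : ℝ :=
  (multivariateGaussian (m i) (S i)).real {y | (-1 : ℝ) ^ (i : ℕ) * discriminant γ π x y < 0}

/-- `B_i = Σ_i^{1/2} (H₁ - H₀) Σ_i^{1/2}`. -/
def matB {p : ℕ} {n : Fin 2 → ℕ} (γ : ℝ) (S : Fin 2 → Matrix (Fin p) (Fin p) ℝ)
    (x : (i : Fin 2) → Fin (n i) → EuclideanSpace ℝ (Fin p)) (i : Fin 2) :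
    Matrix (Fin p) (Fin p) ℝ :=
  CFC.sqrt (S i) * (ridge γ (x 1) - ridge γ (x 0)) * CFC.sqrt (S i)

/-- `r_i = Σ_i^{1/2} [H₁ (m_i - m̂₁) - H₀ (m_i - m̂₀)]`. -/
def vecR {p : ℕ} {n : Fin 2 → ℕ} (γ : ℝ)
    (m : Fin 2 → EuclideanSpace ℝ (Fin p)) (S : Fin 2 → Matrix (Fin p) (Fin p) ℝ)
    (x : (i : Fin 2) → Fin (n i) → EuclideanSpace ℝ (Fin p)) (i : Fin 2) :
    EuclideanSpace ℝ (Fin p) :=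
  act (CFC.sqrt (S i))
    (act (ridge γ (x 1)) (m i - sampleMean (x 1)) - act (ridge γ (x 0)) (m i - sampleMean (x 0)))

/-- `ξ_i = -log (|H₀| / |H₁|) + (m_i - m̂₀)ᵀ H₀ (m_i - m̂₀) - (m_i - m̂₁)ᵀ H₁ (m_i - m̂₁)
+ 2 log (π₁ / π₀)`. -/
def xi {p : ℕ} {n : Fin 2 → ℕ} (γ : ℝ) (π : Fin 2 → ℝ)
    (m : Fin 2 → EuclideanSpace ℝ (Fin p))
    (x : (i : Fin 2) → Fin (n i) → EuclideanSpace ℝ (Fin p)) (i : Fin 2) : ℝ :=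
  -Real.log ((ridge γ (x 0)).det / (ridge γ (x 1)).det)
    + quad (ridge γ (x 0)) (m i - sampleMean (x 0))
    - quad (ridge γ (x 1)) (m i - sampleMean (x 1))
    + 2 * Real.log (π 1 / π 0)

/-- `s_i² = 2 tr B_i² + 4 ‖r_i‖²`. -/
def totalVar {p : ℕ} {n : Fin 2 → ℕ} (γ : ℝ)
    (m : Fin 2 → EuclideanSpace ℝ (Fin p)) (S : Fin 2 → Matrix (Fin p) (Fin p) ℝ)
    (x : (i : Fin 2) → Fin (n i) → EuclideanSpace ℝ (Fin p)) (i : Fin 2) : ℝ :=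
  2 * (matB γ S x i ^ 2).trace + 4 * ‖vecR γ m S x i‖ ^ 2

/-- The ratio `(60 tr B_i² + 240 tr B_i² ‖r_i‖² + 48 ‖r_i‖⁴) / (2 tr B_i² + 4 ‖r_i‖²)²`. -/
def lyapunovRatio {p : ℕ} {n : Fin 2 → ℕ} (γ : ℝ)
    (m : Fin 2 → EuclideanSpace ℝ (Fin p)) (S : Fin 2 → Matrix (Fin p) (Fin p) ℝ)
    (x : (i : Fin 2) → Fin (n i) → EuclideanSpace ℝ (Fin p)) (i : Fin 2) : ℝ :=
  (60 * (matB γ S x i ^ 2).trace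
      + 240 * (matB γ S x i ^ 2).trace * ‖vecR γ m S x i‖ ^ 2
      + 48 * ‖vecR γ m S x i‖ ^ 4) / totalVar γ m S x i ^ 2

/-- A sequence of symmetric matrices `D k` of sizes `p k` has `O(√p)` eigenvalues of order `O(1)`,
and all its other eigenvalues are of order `O(1/√p)`. Eigenvalues are counted with
multiplicity; `J` is the set of indices of those of order `O(1)`. -/
def EigenvalueSplit (p : ℕ → ℕ) (D : (k : ℕ) → Matrix (Fin (p k)) (Fin (p k)) ℝ)
    (hD : ∀ k, (D k).IsHermitian) : Prop :=
  ∃ M : ℝ, 0 < M ∧ ∀ᶠ k in atTop, ∃ J : Finset (Fin (p k)),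
    (J.card : ℝ) ≤ M * √(p k : ℝ) ∧
    (∀ j ∈ J, |(hD k).eigenvalues j| ≤ M) ∧
    (∀ j, j ∉ J → |(hD k).eigenvalues j| ≤ M / √(p k : ℝ))

end

end RQDA

/-!
Conditionally on the training samples, `2 Ŵ(m_i + Σ_i^{1/2} z) + ξ_i` is the quadratic polynomial
`zᵀ B_i z + 2 ⟪r_i, z⟫` of a standard Gaussian vector `z`. In an orthonormal eigenbasis of `B_i`
it equals `tr B_i` plus a sum of independent centred variables `λ_j (z_j² - 1) + 2 b_j z_j`, with
second moment `2 λ_j² + 4 b_j²` and fourth moment `60 λ_j⁴ + 240 λ_j² b_j² + 48 b_j⁴`. Since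
`0 ≤ H₀, H₁ ≤ I`, we have `|λ_j| ≤ ‖Σ_i‖ = O(1)`, and also `b_j² ≤ ‖r_i‖²`; summing over `j` then
turns the assumption on the ratio into Lyapunov's condition. The central limit theorem therefore
gives convergence in law, which for a limit without atoms carries over to thresholds that vary
with `k`.
-/

section Lyapunov

lemma norm_exp_mul_I_sub_taylor_le (y : ℝ) :
    ‖Complex.exp (y * Complex.I) - (1 + y * Complex.I - y ^ 2 / 2)‖ ≤ 4 * |y| ^ 3 := by
  have hI : ((y : ℂ) * Complex.I) ^ 2 = -(y : ℂ) ^ 2 := by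
    rw [mul_pow, Complex.I_sq, mul_neg_one]
  have hsum : ∑ m ∈ Finset.range 3, ((y : ℂ) * Complex.I) ^ m / (m.factorial : ℂ)
      = 1 + y * Complex.I - y ^ 2 / 2 := by
    simp [Finset.sum_range_succ, hI]
    ring
  rcases le_or_gt |y| 1 with hy | hy
  · have h := Complex.exp_bound (x := y * Complex.I) (by simpa using hy) (n := 3) (by norm_num)
    rw [hsum, norm_mul, Complex.norm_I, mul_one, Complex.norm_real, Real.norm_eq_abs] at h
    refine h.trans ?_
    rw [mul_comm]
    gcongr
    norm_num [Nat.factorial]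
  · have hpoly : ‖(1 : ℂ) + y * Complex.I - y ^ 2 / 2‖ ≤ 1 + |y| + |y| ^ 2 / 2 := by
      refine (norm_sub_le _ _).trans (add_le_add ((norm_add_le _ _).trans ?_) ?_) <;> simp
    have h1 : |y| ≤ |y| ^ 3 := le_self_pow₀ hy.le (by norm_num)
    have h2 : |y| ^ 2 ≤ |y| ^ 3 := pow_le_pow_right₀ hy.le (by norm_num)
    calc _ ≤ ‖Complex.exp (y * Complex.I)‖ + ‖(1 : ℂ) + y * Complex.I - y ^ 2 / 2‖ :=
          norm_sub_le _ _
      _ ≤ 1 + (1 + |y| + |y| ^ 2 / 2) := by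
          rw [Complex.norm_exp_ofReal_mul_I]
          gcongr
      _ ≤ 4 * |y| ^ 3 := by linarith

lemma abs_exp_neg_sub_le {a : ℝ} (ha : 0 ≤ a) : |Real.exp (-a) - (1 - a)| ≤ a ^ 2 := by
  rcases le_or_gt a 1 with h | h
  · simpa [abs_of_nonneg ha, h, sub_sub_eq_add_sub, sub_sub, sub_add] using
      Real.norm_exp_sub_one_sub_id_le (x := -a)
  · have h1 : Real.exp (-a) ≤ 1 := Real.exp_le_one_iff.2 (by linarith)
    have h2 := Real.exp_pos (-a)
    rw [abs_of_nonneg (by linarith)]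
    nlinarith

lemma norm_prod_sub_prod_le_sum {ι R : Type*} [NormedCommRing R] [NormOneClass R] (s : Finset ι)
    {a b : ι → R} (ha : ∀ i ∈ s, ‖a i‖ ≤ 1) (hb : ∀ i ∈ s, ‖b i‖ ≤ 1) :
    ‖∏ i ∈ s, a i - ∏ i ∈ s, b i‖ ≤ ∑ i ∈ s, ‖a i - b i‖ := by
  classical
  induction s using Finset.induction_on with
  | empty => simp
  | insert i s hi ih =>
    rw [Finset.forall_mem_insert] at ha hb
    have hprod : ‖∏ j ∈ s, a j‖ ≤ 1 :=
      (Finset.norm_prod_le s a).trans (Finset.prod_le_one (fun _ _ ↦ norm_nonneg _) ha.2)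
    calc _ = ‖(a i - b i) * ∏ j ∈ s, a j + b i * (∏ j ∈ s, a j - ∏ j ∈ s, b j)‖ := by
          rw [Finset.prod_insert hi, Finset.prod_insert hi]
          ring_nf
      _ ≤ ‖a i - b i‖ * ‖∏ j ∈ s, a j‖ + ‖b i‖ * ‖∏ j ∈ s, a j - ∏ j ∈ s, b j‖ :=
          (norm_add_le _ _).trans (add_le_add (norm_mul_le _ _) (norm_mul_le _ _))
      _ ≤ ‖a i - b i‖ * 1 + 1 * ∑ j ∈ s, ‖a j - b j‖ := by
          gcongr
          exacts [hb.1, ih ha.2 hb.2]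
      _ = ∑ j ∈ insert i s, ‖a j - b j‖ := by rw [Finset.sum_insert hi, mul_one, one_mul]

variable {Ω : Type*} {mΩ : MeasurableSpace Ω} {P : Measure Ω} {X : Ω → ℝ}

lemma integrable_pow_of_memLp {n m : ℕ} [IsFiniteMeasure P] (hX : MemLp X n P) (hm : m ≤ n) :
    Integrable (fun ω ↦ X ω ^ m) P := by
  have hX' : MemLp X m P := hX.mono_exponent (by exact_mod_cast hm)
  exact (integrable_norm_iff (hX.aestronglyMeasurable.pow m)).1 <| by
    simpa only [Pi.pow_apply, norm_pow] using hX'.integrable_norm_pow'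

lemma memLp_sq {p : ENNReal} (hX : MemLp X (2 * p) P) : MemLp (fun ω ↦ X ω ^ 2) p P := by
  have : ENNReal.HolderTriple (2 * p) (2 * p) p := ⟨by
    rw [ENNReal.mul_inv (by simp) (by simp), ← add_mul, ENNReal.inv_two_add_inv_two, one_mul]⟩
  simpa only [sq] using! hX.mul hX

lemma memLp_two_sq (hX : MemLp X 4 P) : MemLp (fun ω ↦ X ω ^ 2) 2 P :=
  memLp_sq (by convert! hX; norm_num)

lemma integral_abs_pow_three_le_sqrt [IsFiniteMeasure P] (hX : MemLp X 4 P) :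
    ∫ ω, |X ω| ^ 3 ∂P ≤ √((∫ ω, X ω ^ 2 ∂P) * ∫ ω, X ω ^ 4 ∂P) := by
  have hX2 : MemLp (fun ω ↦ |X ω|) 2 P := (hX.mono_exponent (by norm_num)).abs
  have hholder := integral_mul_le_Lp_mul_Lq_of_nonneg (μ := P) Real.HolderConjugate.two_two
    (.of_forall fun ω ↦ abs_nonneg (X ω)) (.of_forall fun ω ↦ sq_nonneg (X ω))
    (by simpa using hX2) (by simpa using memLp_two_sq hX)
  rw [Real.sqrt_mul (integral_nonneg fun ω ↦ sq_nonneg _), Real.sqrt_eq_rpow, Real.sqrt_eq_rpow]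
  convert! hholder using 5 with ω
  · rw [← sq_abs]; ring
  · rw [Real.rpow_two, sq_abs]
  · rw [Real.rpow_two, ← pow_mul]

variable [IsProbabilityMeasure P]

lemma sq_integral_sq_le_integral_pow_four (hX : MemLp X 4 P) :
    (∫ ω, X ω ^ 2 ∂P) ^ 2 ≤ ∫ ω, X ω ^ 4 ∂P := by
  have hvar := variance_nonneg (fun ω ↦ X ω ^ 2) P
  rw [variance_eq_sub (memLp_two_sq hX)] at hvar
  simp only [Pi.pow_apply, ← pow_mul] at hvar
  linarith

lemma norm_charFun_map_sub_taylor_le (hX : MemLp X 3 P) (h0 : P[X] = 0) (t : ℝ) :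
    ‖charFun (P.map X) t - ((1 - (∫ ω, X ω ^ 2 ∂P) * t ^ 2 / 2 : ℝ) : ℂ)‖
      ≤ 4 * |t| ^ 3 * ∫ ω, |X ω| ^ 3 ∂P := by
  have i1 : Integrable X P := hX.integrable (by norm_num)
  have i2 : Integrable (fun ω ↦ X ω ^ 2) P :=
    integrable_pow_of_memLp (n := 3) (m := 2) (mod_cast hX) (by norm_num)
  have iI : Integrable (fun ω ↦ ((t * X ω : ℝ) : ℂ) * Complex.I) P :=
    ((i1.const_mul t).ofReal (𝕜 := ℂ)).mul_const _
  have iS : Integrable (fun ω ↦ (((t * X ω : ℝ) : ℂ)) ^ 2 / 2) P := by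
    have h : Integrable (fun ω ↦ ((t ^ 2 / 2 * X ω ^ 2 : ℝ) : ℂ)) P := (i2.const_mul _).ofReal
    exact h.congr (.of_forall fun ω ↦ by push_cast; ring)
  have iA : Integrable (fun ω ↦ (1 : ℂ) + ((t * X ω : ℝ) : ℂ) * Complex.I) P :=
    (integrable_const _).add iI
  have hexp : Integrable (fun ω ↦ Complex.exp (((t * X ω : ℝ) : ℂ) * Complex.I)) P := by
    refine Integrable.of_bound (C := 1) ?_ (.of_forall fun ω ↦ ?_)
    · have := hX.aestronglyMeasurable.aemeasurable
      exact (AEMeasurable.cexp (by fun_prop)).aestronglyMeasurable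
    · rw [Complex.norm_exp_ofReal_mul_I]
  have htaylor : ∫ ω, ((1 : ℂ) + ((t * X ω : ℝ) : ℂ) * Complex.I - ((t * X ω : ℝ) : ℂ) ^ 2 / 2) ∂P
      = ((1 - (∫ ω, X ω ^ 2 ∂P) * t ^ 2 / 2 : ℝ) : ℂ) := by
    have hS : ∫ ω, ((t * X ω : ℝ) : ℂ) ^ 2 ∂P = (((∫ ω, X ω ^ 2 ∂P) * t ^ 2 : ℝ) : ℂ) := by
      simp_rw [← Complex.ofReal_pow, integral_complex_ofReal, mul_pow, integral_const_mul]
      rw [mul_comm]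
    rw [integral_sub iA iS, integral_add (integrable_const _) iI,
      integral_mul_const, integral_div, hS, integral_complex_ofReal, integral_const_mul, h0]
    simp
  have hchar : charFun (P.map X) t = ∫ ω, Complex.exp (((t * X ω : ℝ) : ℂ) * Complex.I) ∂P := by
    rw [charFun_apply_real, integral_map hX.aemeasurable (by fun_prop)]
    simp
  rw [hchar, ← htaylor, ← integral_sub hexp (by exact iA.sub iS), ← integral_const_mul]
  refine norm_integral_le_of_norm_le (hX.integrable_norm_pow'.const_mul _) (.of_forall fun ω ↦ ?_)
  simpa only [abs_mul, mul_pow, ← mul_assoc] using norm_exp_mul_I_sub_taylor_le (t * X ω)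

lemma norm_charFun_map_sub_exp_le (hX : MemLp X 4 P) (h0 : P[X] = 0) (t : ℝ) :
    ‖charFun (P.map X) t - ((Real.exp (-((∫ ω, X ω ^ 2 ∂P) * t ^ 2 / 2)) : ℝ) : ℂ)‖
      ≤ 4 * |t| ^ 3 * √((∫ ω, X ω ^ 2 ∂P) * ∫ ω, X ω ^ 4 ∂P) + t ^ 4 * ∫ ω, X ω ^ 4 ∂P := by
  set s := ∫ ω, X ω ^ 2 ∂P
  set q := ∫ ω, X ω ^ 4 ∂P
  have : 0 ≤ s := integral_nonneg fun ω ↦ sq_nonneg _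
  have hsq : s ^ 2 ≤ q := sq_integral_sq_le_integral_pow_four hX
  have hexp : ‖((1 - s * t ^ 2 / 2 : ℝ) : ℂ) - ((Real.exp (-(s * t ^ 2 / 2)) : ℝ) : ℂ)‖
      ≤ t ^ 4 * q := by
    rw [← Complex.ofReal_sub, Complex.norm_real, Real.norm_eq_abs, abs_sub_comm]
    calc _ ≤ (s * t ^ 2 / 2) ^ 2 := abs_exp_neg_sub_le (by positivity)
      _ = t ^ 4 * (s ^ 2 / 4) := by ring
      _ ≤ t ^ 4 * q := by gcongr; linarith [sq_nonneg s]
  have htaylor : ‖charFun (P.map X) t - ((1 - s * t ^ 2 / 2 : ℝ) : ℂ)‖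
      ≤ 4 * |t| ^ 3 * √(s * q) :=
    (norm_charFun_map_sub_taylor_le (hX.mono_exponent (by norm_num)) h0 t).trans <| by
      gcongr
      exact integral_abs_pow_three_le_sqrt hX
  exact (norm_sub_le_norm_sub_add_norm_sub _ _ _).trans (add_le_add htaylor hexp)

lemma norm_charFun_map_sum_sub_exp_le {ι : Type*} [Fintype ι] {X : ι → Ω → ℝ}
    (hX : ∀ j, MemLp (X j) 4 P) (hindep : iIndepFun X P) (h0 : ∀ j, P[X j] = 0) (t : ℝ) :
    ‖charFun (P.map fun ω ↦ ∑ j, X j ω) t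
        - ((Real.exp (-((∑ j, ∫ ω, X j ω ^ 2 ∂P) * t ^ 2 / 2)) : ℝ) : ℂ)‖
      ≤ 4 * |t| ^ 3 * √((∑ j, ∫ ω, X j ω ^ 2 ∂P) * ∑ j, ∫ ω, X j ω ^ 4 ∂P)
        + t ^ 4 * ∑ j, ∫ ω, X j ω ^ 4 ∂P := by
  set s : ι → ℝ := fun j ↦ ∫ ω, X j ω ^ 2 ∂P
  set q : ι → ℝ := fun j ↦ ∫ ω, X j ω ^ 4 ∂P
  have hs (j : ι) : 0 ≤ s j := integral_nonneg fun ω ↦ sq_nonneg _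
  have hq (j : ι) : 0 ≤ q j := integral_nonneg fun ω ↦ by positivity
  have hsum : charFun (P.map fun ω ↦ ∑ j, X j ω) t = ∏ j, charFun (P.map (X j)) t := by
    rw [(hindep.restrict _).charFun_map_fun_finsetSum_eq_prod
      (fun j _ ↦ (hX j).aemeasurable), Finset.prod_apply]
  have hexp : ((Real.exp (-((∑ j, s j) * t ^ 2 / 2)) : ℝ) : ℂ)
      = ∏ j, ((Real.exp (-(s j * t ^ 2 / 2)) : ℝ) : ℂ) := by
    rw [← Complex.ofReal_prod, ← Real.exp_sum, Finset.sum_neg_distrib, ← Finset.sum_div,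
      ← Finset.sum_mul]
  have hexp_le (j : ι) : ‖((Real.exp (-(s j * t ^ 2 / 2)) : ℝ) : ℂ)‖ ≤ 1 := by
    rw [Complex.norm_real, Real.norm_of_nonneg (Real.exp_nonneg _), Real.exp_le_one_iff, neg_nonpos]
    have := hs j
    positivity
  have hchar_le (j : ι) : ‖charFun (P.map (X j)) t‖ ≤ 1 :=
    have := Measure.isProbabilityMeasure_map (hX j).aemeasurable
    norm_charFun_le_one _
  rw [hsum, hexp]
  calc _ ≤ ∑ j, ‖charFun (P.map (X j)) t - ((Real.exp (-(s j * t ^ 2 / 2)) : ℝ) : ℂ)‖ :=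
        norm_prod_sub_prod_le_sum _ (fun j _ ↦ hchar_le j) fun j _ ↦ hexp_le j
    _ ≤ ∑ j, (4 * |t| ^ 3 * √(s j * q j) + t ^ 4 * q j) :=
        Finset.sum_le_sum fun j _ ↦ norm_charFun_map_sub_exp_le (hX j) (h0 j) t
    _ = 4 * |t| ^ 3 * ∑ j, √(s j) * √(q j) + t ^ 4 * ∑ j, q j := by
        simp_rw [Finset.sum_add_distrib, ← Finset.mul_sum, Real.sqrt_mul (hs _)]
    _ ≤ _ := by
        gcongr
        rw [Real.sqrt_mul (Finset.sum_nonneg fun j _ ↦ hs j)]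
        exact Real.sum_sqrt_mul_sqrt_le _ hs hq

/-- **Lyapunov's central limit theorem** for row-wise independent triangular arrays, with fourth
moments. -/
theorem tendstoInDistribution_sum_of_lyapunov {ι : ℕ → Type*} [∀ k, Fintype (ι k)]
    {Ω : ℕ → Type*} {mΩ : ∀ k, MeasurableSpace (Ω k)} {P : ∀ k, Measure (Ω k)}
    [∀ k, IsProbabilityMeasure (P k)] {X : ∀ k, ι k → Ω k → ℝ}
    {Ω' : Type*} {mΩ' : MeasurableSpace Ω'} {P' : Measure Ω'} [IsProbabilityMeasure P'] {Y : Ω' → ℝ}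
    (hX : ∀ k j, MemLp (X k j) 4 (P k)) (hindep : ∀ k, iIndepFun (X k) (P k))
    (hmean : ∀ k j, ∫ ω, X k j ω ∂(P k) = 0)
    (hvar : ∀ᶠ k in atTop, ∑ j, ∫ ω, X k j ω ^ 2 ∂(P k) = 1)
    (hlyap : Tendsto (fun k ↦ ∑ j, ∫ ω, X k j ω ^ 4 ∂(P k)) atTop (𝓝 0))
    (hY : HasLaw Y (gaussianReal 0 1) P') :
    TendstoInDistribution (fun k ω ↦ ∑ j, X k j ω) atTop Y P P' where
  forall_aemeasurable k := Finset.aemeasurable_fun_sum _ fun j _ ↦ (hX k j).aemeasurable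
  tendsto := by
    refine ProbabilityMeasure.tendsto_iff_tendsto_charFun.2 fun t ↦ ?_
    rw! [hY.map_eq]
    have hbound : Tendsto (fun k ↦ 4 * |t| ^ 3 * √(∑ j, ∫ ω, X k j ω ^ 4 ∂(P k))
        + t ^ 4 * ∑ j, ∫ ω, X k j ω ^ 4 ∂(P k)) atTop (𝓝 0) := by
      simpa using (hlyap.sqrt.const_mul (4 * |t| ^ 3)).add (hlyap.const_mul (t ^ 4))
    rw [tendsto_iff_norm_sub_tendsto_zero]
    refine squeeze_zero' (.of_forall fun k ↦ norm_nonneg _) ?_ hbound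
    filter_upwards [hvar] with k hk
    simpa [hk, charFun_gaussianReal] using
      norm_charFun_map_sum_sub_exp_le (hX k) (hindep k) (hmean k) t

end Lyapunov

section GaussianMoments

lemma integral_pow_gaussianReal_eq_iteratedDeriv (n : ℕ) :
    ∫ z, z ^ n ∂(gaussianReal 0 1) = iteratedDeriv n (fun t : ℝ ↦ Real.exp (t ^ 2 / 2)) 0 := by
  simpa [mgf_id_gaussianReal] using
    (iteratedDeriv_mgf_zero (X := id) (μ := gaussianReal 0 1) (by simp) n).symm

lemma integral_pow_add_two_gaussianReal (n : ℕ) :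
    ∫ z, z ^ (n + 2) ∂(gaussianReal 0 1) = (n + 1) * ∫ z, z ^ n ∂(gaussianReal 0 1) := by
  have hderiv : deriv (fun t : ℝ ↦ Real.exp (t ^ 2 / 2)) = fun t ↦ t * Real.exp (t ^ 2 / 2) := by
    ext t
    exact ((hasDerivAt_pow 2 t).div_const 2).exp.deriv.trans (by push_cast; ring)
  rw [integral_pow_gaussianReal_eq_iteratedDeriv, integral_pow_gaussianReal_eq_iteratedDeriv,
    iteratedDeriv_succ', hderiv, iteratedDeriv_fun_mul (by fun_prop) (by fun_prop)]
  simp [iteratedDeriv_fun_id_zero]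

lemma integrable_pow_gaussianReal (n : ℕ) :
    Integrable (fun z : ℝ ↦ z ^ n) (gaussianReal 0 1) :=
  integrable_pow_of_memLp (X := id) (memLp_id_gaussianReal' _ (ENNReal.natCast_ne_top n)) le_rfl

lemma integral_sum_mul_pow_gaussianReal {n : ℕ} (c : Fin n → ℝ) :
    ∫ z, ∑ k, c k * z ^ (k : ℕ) ∂(gaussianReal 0 1)
      = ∑ k, c k * ∫ z, z ^ (k : ℕ) ∂(gaussianReal 0 1) := by
  rw [integral_finsetSum _ fun k _ ↦ (integrable_pow_gaussianReal _).const_mul _]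
  simp_rw [integral_const_mul]

/-- The quadratic polynomial `a (z² - 1) + 2 b z`, a combination of the Hermite polynomials of
degrees 1 and 2, so that it is centred when `z` is standard Gaussian. -/
def hermiteQuadratic (a b z : ℝ) : ℝ := a * (z ^ 2 - 1) + 2 * b * z

lemma memLp_hermiteQuadratic (a b : ℝ) : MemLp (hermiteQuadratic a b) 4 (gaussianReal 0 1) := by
  have hid : MemLp (fun z : ℝ ↦ z) (2 * 4) (gaussianReal 0 1) :=
    memLp_id_gaussianReal' _ (ENNReal.mul_ne_top (by simp) (by simp))
  have hlin : MemLp (fun z : ℝ ↦ z) 4 (gaussianReal 0 1) := memLp_id_gaussianReal' 4 (by simp)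
  exact (((memLp_sq hid).sub (memLp_const 1)).const_mul a).add (hlin.const_mul (2 * b))

lemma integral_hermiteQuadratic (a b : ℝ) :
    ∫ z, hermiteQuadratic a b z ∂(gaussianReal 0 1) = 0 := by
  have hpoly (z : ℝ) : hermiteQuadratic a b z = ∑ k : Fin 3, ![-a, 2 * b, a] k * z ^ (k : ℕ) := by
    simp [Fin.sum_univ_succ, hermiteQuadratic]
    ring
  simp_rw [hpoly, integral_sum_mul_pow_gaussianReal]
  simp [Fin.sum_univ_succ, integral_pow_add_two_gaussianReal, integral_id_gaussianReal]

lemma integral_hermiteQuadratic_sq (a b : ℝ) :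
    ∫ z, hermiteQuadratic a b z ^ 2 ∂(gaussianReal 0 1) = 2 * a ^ 2 + 4 * b ^ 2 := by
  have hpoly (z : ℝ) : hermiteQuadratic a b z ^ 2 = ∑ k : Fin 5,
      ![a ^ 2, -4 * a * b, 4 * b ^ 2 - 2 * a ^ 2, 4 * a * b, a ^ 2] k * z ^ (k : ℕ) := by
    simp [Fin.sum_univ_succ, hermiteQuadratic]
    ring
  simp_rw [hpoly, integral_sum_mul_pow_gaussianReal]
  simp [Fin.sum_univ_succ, integral_pow_add_two_gaussianReal, integral_id_gaussianReal]
  ring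

lemma integral_hermiteQuadratic_pow_four (a b : ℝ) :
    ∫ z, hermiteQuadratic a b z ^ 4 ∂(gaussianReal 0 1)
      = 60 * a ^ 4 + 240 * a ^ 2 * b ^ 2 + 48 * b ^ 4 := by
  have hpoly (z : ℝ) : hermiteQuadratic a b z ^ 4 = ∑ k : Fin 9,
      ![a ^ 4, -8 * a ^ 3 * b, 24 * a ^ 2 * b ^ 2 - 4 * a ^ 4, 24 * a ^ 3 * b - 32 * a * b ^ 3,
        16 * b ^ 4 - 48 * a ^ 2 * b ^ 2 + 6 * a ^ 4, 32 * a * b ^ 3 - 24 * a ^ 3 * b,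
        24 * a ^ 2 * b ^ 2 - 4 * a ^ 4, 8 * a ^ 3 * b, a ^ 4] k * z ^ (k : ℕ) := by
    simp [Fin.sum_univ_succ, hermiteQuadratic]
    ring
  simp_rw [hpoly, integral_sum_mul_pow_gaussianReal]
  simp [Fin.sum_univ_succ, integral_pow_add_two_gaussianReal, integral_id_gaussianReal]
  ring

theorem tendstoInDistribution_sum_hermiteQuadratic {ι : ℕ → Type*} [∀ k, Fintype (ι k)]
    {a b : ∀ k, ι k → ℝ} {v : ℕ → ℝ} (hv : ∀ k, v k = ∑ j, (2 * a k j ^ 2 + 4 * b k j ^ 2))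
    (hpos : ∀ᶠ k in atTop, 0 < v k)
    (hlyap : Tendsto (fun k ↦ (∑ j, (60 * a k j ^ 4 + 240 * a k j ^ 2 * b k j ^ 2
      + 48 * b k j ^ 4)) / v k ^ 2) atTop (𝓝 0)) :
    TendstoInDistribution (fun k z ↦ (∑ j, hermiteQuadratic (a k j) (b k j) (z j)) / √(v k)) atTop
      id (fun k ↦ Measure.pi fun _ : ι k ↦ gaussianReal 0 1) (gaussianReal 0 1) := by
  have hv0 (k : ℕ) : 0 ≤ v k := by
    rw [hv]
    positivity
  have hmeas (k : ℕ) (j : ι k) : Measurable (hermiteQuadratic (a k j) (b k j)) := by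
    unfold hermiteQuadratic
    fun_prop
  have hmoment (k : ℕ) (j : ι k) (n : ℕ) :
      ∫ z, (hermiteQuadratic (a k j) (b k j) (z j) / √(v k)) ^ n
          ∂(Measure.pi fun _ : ι k ↦ gaussianReal 0 1)
        = (∫ z, hermiteQuadratic (a k j) (b k j) z ^ n ∂(gaussianReal 0 1)) / √(v k) ^ n := by
    have hint := integral_map (μ := Measure.pi fun _ : ι k ↦ gaussianReal 0 1)
      (measurable_pi_apply j).aemeasurable
      (f := fun z ↦ (hermiteQuadratic (a k j) (b k j) z / √(v k)) ^ n) (by fun_prop)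
    have hmap : (Measure.pi fun _ : ι k ↦ gaussianReal 0 1).map (fun z ↦ z j) = gaussianReal 0 1 :=
      (measurePreserving_eval _ j).map_eq
    rw [← hint, hmap]
    simp_rw [div_pow, integral_div]
  simp_rw [Finset.sum_div]
  refine tendstoInDistribution_sum_of_lyapunov (fun k j ↦ ?_) (fun k ↦ ?_) (fun k j ↦ ?_) ?_ ?_
    HasLaw.id
  · exact ((memLp_hermiteQuadratic _ _).mul_const _).comp_measurePreserving
      (measurePreserving_eval _ j)
  · exact iIndepFun_pi (X := fun j z ↦ hermiteQuadratic (a k j) (b k j) z / √(v k))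
      fun j ↦ (by fun_prop)
  · simpa [integral_hermiteQuadratic] using hmoment k j 1
  · filter_upwards [hpos] with k hk
    simp_rw [hmoment, integral_hermiteQuadratic_sq, Real.sq_sqrt (hv0 k), ← Finset.sum_div, ← hv]
    exact div_self hk.ne'
  · have hsqrt (k : ℕ) : √(v k) ^ 4 = v k ^ 2 := by
      rw [show 4 = 2 * 2 by norm_num, pow_mul, Real.sq_sqrt (hv0 k)]
    simpa only [hmoment, integral_hermiteQuadratic_pow_four, hsqrt, ← Finset.sum_div] using hlyap

end GaussianMoments

section VaryingThresholds

variable {ι : Type*} {l : Filter ι} {ν : ι → ProbabilityMeasure ℝ} {μ : ProbabilityMeasure ℝ}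
  [NullSingletonClass (μ : Measure ℝ)]

-- For `E = {(t, y) | t < y}`, the left side is `(ν k ⊗ δ_{x k}) E`, and the frontier of `E` lies in
-- the diagonal, which is null for `μ ⊗ δ_y`.
lemma tendsto_measureReal_Iio_of_tendsto_coe_ereal (hν : Tendsto ν l (𝓝 μ)) {x : ι → ℝ}
    {y : EReal} (hx : Tendsto (fun k ↦ (x k : EReal)) l (𝓝 y)) :
    Tendsto (fun k ↦ (ν k : Measure ℝ).real (Set.Iio (x k))) l
      (𝓝 ((μ : Measure ℝ).real {t | (t : EReal) < y})) := by
  set E : Set (ℝ × EReal) := {q | (q.1 : EReal) < q.2} with hE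
  have hcoe : Continuous fun q : ℝ × EReal ↦ (q.1 : EReal) :=
    continuous_coe_real_ereal.comp continuous_fst
  have hEmeas : MeasurableSet E := (isOpen_lt hcoe continuous_snd).measurableSet
  have hprod : Tendsto (fun k ↦ (ν k).prod (diracProba (x k : EReal))) l
      (𝓝 (μ.prod (diracProba y))) :=
    (ProbabilityMeasure.continuous_prod.tendsto (μ, diracProba y)).comp
      (hν.prodMk_nhds ((continuous_diracProba.tendsto y).comp hx))
  have hsection (κ : ProbabilityMeasure ℝ) (z : EReal) {A : Set (ℝ × EReal)}
      (hA : MeasurableSet A) :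
      (κ.prod (diracProba z) : Measure (ℝ × EReal)) A = (κ : Measure ℝ) {t | (t, z) ∈ A} := by
    rw [ProbabilityMeasure.toMeasure_prod, diracProba, ProbabilityMeasure.coe_mk,
      Measure.prod_dirac, Measure.map_apply measurable_prodMk_right hA]
    rfl
  have hfrontier : (μ.prod (diracProba y) : Measure (ℝ × EReal)) (frontier E) = 0 := by
    rw [hsection _ _ isClosed_frontier.measurableSet]
    refine Set.Subsingleton.measure_zero (fun s hs t ht ↦ ?_) _
    have hdiag := frontier_lt_subset_eq hcoe continuous_snd
    exact EReal.coe_injective ((hdiag hs).trans (hdiag ht).symm)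
  have hlim := ProbabilityMeasure.tendsto_measure_of_null_frontier_of_tendsto' hprod hfrontier
  simp_rw [hsection _ _ hEmeas] at hlim
  simpa [hE, Measure.real, Set.Iio, Function.comp_def] using
    (ENNReal.tendsto_toReal (measure_ne_top _ _)).comp hlim

theorem tendsto_measureReal_Iio_sub_cdf (hν : Tendsto ν l (𝓝 μ)) (x : ι → ℝ) :
    Tendsto (fun k ↦ (ν k : Measure ℝ).real (Set.Iio (x k)) - cdf (μ : Measure ℝ) (x k)) l
      (𝓝 0) := by
  -- Along an ultrafilter the thresholds converge in `[-∞, ∞]`.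
  refine (tendsto_iff_ultrafilter _ _ _).2 fun u hu ↦ ?_
  obtain ⟨y, -, hy⟩ := isCompact_univ.ultrafilter_le_nhds (u.map fun k ↦ (x k : EReal)) (by simp)
  have hcdf (k : ι) : cdf (μ : Measure ℝ) (x k) = (μ : Measure ℝ).real (Set.Iio (x k)) := by
    rw [cdf_eq_real]
    exact measureReal_congr Iio_ae_eq_Iic.symm
  simp_rw [hcdf]
  simpa using (tendsto_measureReal_Iio_of_tendsto_coe_ereal (hν.mono_left hu) hy).sub
    (tendsto_measureReal_Iio_of_tendsto_coe_ereal (ν := fun _ ↦ μ) tendsto_const_nhds hy)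

theorem tendsto_measureReal_lt_sub_cdf_map {Ω : ι → Type*} [∀ k, MeasurableSpace (Ω k)]
    {P : ∀ k, Measure (Ω k)} [∀ k, IsProbabilityMeasure (P k)] {X : ∀ k, Ω k → ℝ}
    {Ω' : Type*} [MeasurableSpace Ω'] {Q : Measure Ω'} [IsProbabilityMeasure Q] {Z : Ω' → ℝ}
    [NullSingletonClass (Q.map Z)] (h : TendstoInDistribution X l Z P Q) (x : ι → ℝ) :
    Tendsto (fun k ↦ (P k).real {ω | X k ω < x k} - cdf (Q.map Z) (x k)) l (𝓝 0) := by
  let μ : ProbabilityMeasure ℝ :=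
    ⟨Q.map Z, Measure.isProbabilityMeasure_map h.aemeasurable_limit⟩
  have : NullSingletonClass (μ : Measure ℝ) := ‹NullSingletonClass (Q.map Z)›
  refine (tendsto_measureReal_Iio_sub_cdf (μ := μ) h.tendsto x).congr fun k ↦ ?_
  rw [ProbabilityMeasure.coe_mk, ProbabilityMeasure.coe_mk,
    map_measureReal_apply_of_aemeasurable (h.forall_aemeasurable k) measurableSet_Iio]
  rfl

end VaryingThresholds

namespace RQDA

section Matrices

variable {p : ℕ} {A B M : Matrix (Fin p) (Fin p) ℝ}

lemma act_mul (A B : Matrix (Fin p) (Fin p) ℝ) (v : EuclideanSpace ℝ (Fin p)) :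
    act (A * B) v = act A (act B v) := by
  simp [act]

lemma act_sub_left (A B : Matrix (Fin p) (Fin p) ℝ) (v : EuclideanSpace ℝ (Fin p)) :
    act (A - B) v = act A v - act B v := by
  simp [act]

@[fun_prop]
lemma continuous_act (A : Matrix (Fin p) (Fin p) ℝ) : Continuous (act A) := by
  unfold act
  fun_prop

@[fun_prop]
lemma continuous_quad (A : Matrix (Fin p) (Fin p) ℝ) : Continuous (quad A) := by
  unfold quad
  fun_prop

lemma inner_act_left (hA : A.IsHermitian) (v w : EuclideanSpace ℝ (Fin p)) :
    inner ℝ (act A v) w = inner ℝ v (act A w) := by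
  have hself : IsSelfAdjoint (Matrix.toEuclideanCLM (𝕜 := ℝ) A) :=
    IsSelfAdjoint.map (f := Matrix.toEuclideanCLM (n := Fin p) (𝕜 := ℝ)) hA
  rw [act, ← ContinuousLinearMap.adjoint_inner_right, hself.adjoint_eq, act]

lemma quad_add (hA : A.IsHermitian) (v w : EuclideanSpace ℝ (Fin p)) :
    quad A (v + w) = quad A v + 2 * inner ℝ w (act A v) + quad A w := by
  have hadd : act A (v + w) = act A v + act A w := map_add _ v w
  rw [quad, hadd, inner_add_left, inner_add_right, inner_add_right, ← inner_act_left hA v w,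
    real_inner_comm w, quad, quad]
  ring

lemma quad_mul_sub_mul (hA : A.IsHermitian) (M N : Matrix (Fin p) (Fin p) ℝ)
    (v : EuclideanSpace ℝ (Fin p)) :
    quad (A * (M - N) * A) v = quad M (act A v) - quad N (act A v) := by
  rw [quad, act_mul, act_mul, ← inner_act_left hA, act_sub_left, inner_sub_right, quad, quad]

lemma quad_nonneg (hA : A.PosSemidef) (v : EuclideanSpace ℝ (Fin p)) : 0 ≤ quad A v := by
  rw [quad, act, inner_toEuclideanCLM]
  simpa using hA.dotProduct_mulVec_nonneg v.ofLp

lemma quad_le_specNorm_mul (A : Matrix (Fin p) (Fin p) ℝ) (v : EuclideanSpace ℝ (Fin p)) :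
    quad A v ≤ specNorm A * ‖v‖ ^ 2 :=
  calc quad A v ≤ ‖v‖ * ‖act A v‖ := real_inner_le_norm _ _
    _ ≤ ‖v‖ * (specNorm A * ‖v‖) := by
      gcongr
      exact ContinuousLinearMap.le_opNorm _ v
    _ = specNorm A * ‖v‖ ^ 2 := by ring

lemma isHermitian_sqrt (A : Matrix (Fin p) (Fin p) ℝ) : (CFC.sqrt A).IsHermitian :=
  (CFC.sqrt_nonneg A).isSelfAdjoint

lemma norm_act_sqrt_sq_le (hA : A.PosSemidef) (v : EuclideanSpace ℝ (Fin p)) :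
    ‖act (CFC.sqrt A) v‖ ^ 2 ≤ specNorm A * ‖v‖ ^ 2 := by
  rw [← real_inner_self_eq_norm_sq, inner_act_left (isHermitian_sqrt A), ← act_mul,
    CFC.sqrt_mul_sqrt_self _ hA.nonneg]
  exact quad_le_specNorm_mul A v

lemma quad_inv_one_add_mem_Icc (hM : M.PosSemidef) (w : EuclideanSpace ℝ (Fin p)) :
    quad (1 + M)⁻¹ w ∈ Set.Icc 0 (‖w‖ ^ 2) := by
  have hdet : IsUnit (1 + M).det :=
    (Matrix.isUnit_iff_isUnit_det _).1 (Matrix.PosDef.one.add_posSemidef hM).isUnit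
  set u := act (1 + M)⁻¹ w with hu
  have hw : w = u + act M u := by
    have hcancel : act (1 + M) u = w := by
      rw [hu, ← act_mul, Matrix.mul_nonsing_inv _ hdet]
      simp [act]
    rw [← hcancel]
    simp [act]
  have hMu : 0 ≤ quad M u := quad_nonneg hM u
  have hquad : quad (1 + M)⁻¹ w = ‖u‖ ^ 2 + quad M u := by
    rw [quad, ← hu, hw, inner_add_left, real_inner_self_eq_norm_sq, real_inner_comm, quad]
  have hnorm : ‖w‖ ^ 2 = ‖u‖ ^ 2 + 2 * quad M u + ‖act M u‖ ^ 2 := by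
    rw [hw, norm_add_sq_real, quad]
  rw [hquad, hnorm]
  constructor <;> nlinarith [sq_nonneg ‖u‖, sq_nonneg ‖act M u‖]

lemma act_eigenvectorBasis (hB : B.IsHermitian) (j : Fin p) :
    act B (hB.eigenvectorBasis j) = hB.eigenvalues j • hB.eigenvectorBasis j := by
  ext i
  exact congrFun (hB.mulVec_eigenvectorBasis j) i

lemma quad_eigenvectorBasis (hB : B.IsHermitian) (j : Fin p) :
    quad B (hB.eigenvectorBasis j) = hB.eigenvalues j := by
  rw [quad, act_eigenvectorBasis, inner_smul_right, real_inner_self_eq_norm_sq,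
    hB.eigenvectorBasis.norm_eq_one]
  ring

lemma trace_sq_eq_sum_eigenvalues_sq (hB : B.IsHermitian) :
    (B ^ 2).trace = ∑ j, hB.eigenvalues j ^ 2 := by
  conv_lhs => rw [hB.spectral_theorem]
  rw [← map_pow, Unitary.conjStarAlgAut_apply, Matrix.trace_mul_cycle, Unitary.coe_star_mul_self,
    one_mul, Matrix.diagonal_pow, Matrix.trace_diagonal]
  simp

lemma quad_sum_smul_eigenvectorBasis (hB : B.IsHermitian) (z : Fin p → ℝ) :
    quad B (∑ j, z j • hB.eigenvectorBasis j) = ∑ j, hB.eigenvalues j * z j ^ 2 := by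
  have hact : act B (∑ j, z j • hB.eigenvectorBasis j)
      = ∑ j, (z j * hB.eigenvalues j) • hB.eigenvectorBasis j := by
    simp only [mul_smul, ← act_eigenvectorBasis]
    simp [act]
  rw [quad, hact, hB.eigenvectorBasis.orthonormal.inner_sum]
  refine Finset.sum_congr rfl fun j _ ↦ ?_
  rw [conj_trivial]
  ring

lemma quad_add_two_mul_inner_sum_smul_eigenvectorBasis (hB : B.IsHermitian)
    (r : EuclideanSpace ℝ (Fin p)) (z : Fin p → ℝ) :
    quad B (∑ j, z j • hB.eigenvectorBasis j) + 2 * inner ℝ r (∑ j, z j • hB.eigenvectorBasis j)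
      = ∑ j, hermiteQuadratic (hB.eigenvalues j) (inner ℝ r (hB.eigenvectorBasis j)) (z j)
        + B.trace := by
  rw [quad_sum_smul_eigenvectorBasis, inner_sum, Finset.mul_sum, hB.trace_eq_sum_eigenvalues,
    ← Finset.sum_add_distrib, ← Finset.sum_add_distrib]
  refine Finset.sum_congr rfl fun j _ ↦ ?_
  rw [inner_smul_right, hermiteQuadratic, RCLike.ofReal_real_eq_id, id]
  ring

end Matrices

section Discriminant

variable {p : ℕ}

lemma posSemidef_sampleCov {n : ℕ} (x : Fin n → EuclideanSpace ℝ (Fin p)) :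
    (sampleCov x).PosSemidef := by
  rcases n.eq_zero_or_pos with rfl | hn
  · simpa [sampleCov] using Matrix.PosSemidef.zero
  · have hn' : (1 : ℝ) ≤ n := mod_cast hn
    refine Matrix.PosSemidef.smul (Matrix.posSemidef_sum _ fun l _ ↦ ?_)
      (one_div_nonneg.2 (sub_nonneg.2 hn'))
    simpa using Matrix.posSemidef_vecMulVec_self_star (x l - sampleMean x).ofLp

lemma isHermitian_ridge {n : ℕ} (γ : ℝ) (x : Fin n → EuclideanSpace ℝ (Fin p)) :
    (ridge γ x).IsHermitian :=
  (Matrix.isHermitian_one.add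
    ((posSemidef_sampleCov x).isHermitian.smul (IsSelfAdjoint.all γ))).inv

variable {n : Fin 2 → ℕ} (γ : ℝ) (π : Fin 2 → ℝ) (m : Fin 2 → EuclideanSpace ℝ (Fin p))
  (S : Fin 2 → Matrix (Fin p) (Fin p) ℝ)
  (x : (i : Fin 2) → Fin (n i) → EuclideanSpace ℝ (Fin p)) (i : Fin 2)

lemma isHermitian_matB : (matB γ S x i).IsHermitian := by
  have hsub := (isHermitian_ridge γ (x 1)).sub (isHermitian_ridge γ (x 0))
  simpa only [matB, (isHermitian_sqrt (S i)).eq] using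
    Matrix.isHermitian_mul_mul_conjTranspose (CFC.sqrt (S i)) hsub

@[fun_prop]
lemma continuous_discriminant : Continuous (discriminant γ π x) := by
  unfold discriminant
  fun_prop

lemma discriminant_add_act_sqrt (z : EuclideanSpace ℝ (Fin p)) :
    discriminant γ π x (m i + act (CFC.sqrt (S i)) z)
      = (quad (matB γ S x i) z + 2 * inner ℝ (vecR γ m S x i) z - xi γ π m x i) / 2 := by
  have hsqrt := isHermitian_sqrt (S i)
  have hr : inner ℝ (vecR γ m S x i) z
      = inner ℝ (act (CFC.sqrt (S i)) z) (act (ridge γ (x 1)) (m i - sampleMean (x 1)))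
        - inner ℝ (act (CFC.sqrt (S i)) z) (act (ridge γ (x 0)) (m i - sampleMean (x 0))) := by
    rw [vecR, inner_act_left hsqrt, real_inner_comm, inner_sub_right]
  rw [discriminant, xi, matB, quad_mul_sub_mul hsqrt, hr, add_sub_right_comm (m i),
    add_sub_right_comm (m i), quad_add (isHermitian_ridge γ (x 0)),
    quad_add (isHermitian_ridge γ (x 1))]
  ring

/-- The coefficient `(-1)^i λ_j` of `z_j² - 1` in `2 (-1)^i Ŵ(m_i + Σ_i^{1/2} z)`, where `λ_j` is
the `j`-th eigenvalue of `B_i` and `z_j` the `j`-th coordinate of `z` in an eigenbasis of `B_i`. -/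
noncomputable def quadCoeff (j : Fin p) : ℝ :=
  (-1) ^ (i : ℕ) * (isHermitian_matB γ S x i).eigenvalues j

/-- Half the coefficient of `z_j` in `2 (-1)^i Ŵ(m_i + Σ_i^{1/2} z)`, with `z_j` the `j`-th
coordinate of `z` in the eigenbasis of `B_i` used in `quadCoeff`. -/
noncomputable def linCoeff (j : Fin p) : ℝ :=
  (-1) ^ (i : ℕ) * inner ℝ (vecR γ m S x i) ((isHermitian_matB γ S x i).eigenvectorBasis j)

lemma quadCoeff_sq (j : Fin p) :
    quadCoeff γ S x i j ^ 2 = (isHermitian_matB γ S x i).eigenvalues j ^ 2 := by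
  rw [quadCoeff, mul_pow, ← pow_mul, mul_comm (i : ℕ), pow_mul, neg_one_sq, one_pow, one_mul]

lemma linCoeff_sq (j : Fin p) :
    linCoeff γ m S x i j ^ 2
      = inner ℝ (vecR γ m S x i) ((isHermitian_matB γ S x i).eigenvectorBasis j) ^ 2 := by
  rw [linCoeff, mul_pow, ← pow_mul, mul_comm (i : ℕ), pow_mul, neg_one_sq, one_pow, one_mul]

lemma sum_quadCoeff_sq : ∑ j, quadCoeff γ S x i j ^ 2 = (matB γ S x i ^ 2).trace := by
  simp_rw [quadCoeff_sq, trace_sq_eq_sum_eigenvalues_sq (isHermitian_matB γ S x i)]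

lemma sum_linCoeff_sq : ∑ j, linCoeff γ m S x i j ^ 2 = ‖vecR γ m S x i‖ ^ 2 := by
  simp_rw [linCoeff_sq, OrthonormalBasis.sum_sq_inner_left]

lemma totalVar_eq_sum :
    totalVar γ m S x i
      = ∑ j, (2 * quadCoeff γ S x i j ^ 2 + 4 * linCoeff γ m S x i j ^ 2) := by
  rw [Finset.sum_add_distrib, ← Finset.mul_sum, ← Finset.mul_sum, sum_quadCoeff_sq,
    sum_linCoeff_sq, totalVar]

lemma linCoeff_sq_le (j : Fin p) : linCoeff γ m S x i j ^ 2 ≤ ‖vecR γ m S x i‖ ^ 2 := by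
  rw [← sum_linCoeff_sq]
  exact Finset.single_le_sum (fun _ _ ↦ sq_nonneg _) (Finset.mem_univ j)

variable {γ S}

lemma quadCoeff_sq_le (hγ : 0 ≤ γ) (hS : (S i).PosSemidef) (j : Fin p) :
    quadCoeff γ S x i j ^ 2 ≤ specNorm (S i) ^ 2 := by
  set w := act (CFC.sqrt (S i)) ((isHermitian_matB γ S x i).eigenvectorBasis j)
  have heigen : (isHermitian_matB γ S x i).eigenvalues j
      = quad (ridge γ (x 1)) w - quad (ridge γ (x 0)) w := by
    rw [← quad_mul_sub_mul (isHermitian_sqrt (S i)), ← matB, quad_eigenvectorBasis]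
  have hw : ‖w‖ ^ 2 ≤ specNorm (S i) := by
    simpa using norm_act_sqrt_sq_le hS ((isHermitian_matB γ S x i).eigenvectorBasis j)
  have hridge (a : Fin 2) : quad (ridge γ (x a)) w ∈ Set.Icc 0 (‖w‖ ^ 2) :=
    quad_inv_one_add_mem_Icc ((posSemidef_sampleCov (x a)).smul hγ) w
  rw [quadCoeff_sq, heigen]
  exact sq_le_sq' (by linarith [(hridge 0).2, (hridge 1).1])
    (by linarith [(hridge 0).1, (hridge 1).2])

lemma sum_fourth_moment_div_totalVar_sq_le (hγ : 0 ≤ γ) (hS : (S i).PosSemidef) :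
    (∑ j, (60 * quadCoeff γ S x i j ^ 4
      + 240 * quadCoeff γ S x i j ^ 2 * linCoeff γ m S x i j ^ 2
      + 48 * linCoeff γ m S x i j ^ 4)) / totalVar γ m S x i ^ 2
      ≤ (1 + specNorm (S i) ^ 2) * lyapunovRatio γ m S x i := by
  set a := quadCoeff γ S x i
  set b := linCoeff γ m S x i
  set R := ‖vecR γ m S x i‖ ^ 2
  set T := (matB γ S x i ^ 2).trace
  set C := specNorm (S i) ^ 2
  have hT : ∑ j, a j ^ 2 = T := sum_quadCoeff_sq γ S x i
  have hR : ∑ j, b j ^ 2 = R := sum_linCoeff_sq γ m S x i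
  have hterm (j : Fin p) : 60 * a j ^ 4 + 240 * a j ^ 2 * b j ^ 2 + 48 * b j ^ 4
      ≤ (60 * C + 240 * R) * a j ^ 2 + 48 * R * b j ^ 2 := by
    have ha : a j ^ 2 * a j ^ 2 ≤ C * a j ^ 2 := by
      gcongr
      exact quadCoeff_sq_le x i hγ hS j
    have hab : b j ^ 2 * a j ^ 2 ≤ R * a j ^ 2 := by
      gcongr
      exact linCoeff_sq_le γ m S x i j
    have hb : b j ^ 2 * b j ^ 2 ≤ R * b j ^ 2 := by
      gcongr
      exact linCoeff_sq_le γ m S x i j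
    linarith
  have hT0 : 0 ≤ T := hT ▸ Finset.sum_nonneg fun _ _ ↦ sq_nonneg _
  have hR0 : 0 ≤ R := sq_nonneg _
  have hC0 : 0 ≤ C := sq_nonneg _
  have hsum : ∑ j, (60 * a j ^ 4 + 240 * a j ^ 2 * b j ^ 2 + 48 * b j ^ 4)
      ≤ (1 + C) * (60 * T + 240 * T * R + 48 * R ^ 2) :=
    calc ∑ j, (60 * a j ^ 4 + 240 * a j ^ 2 * b j ^ 2 + 48 * b j ^ 4)
        ≤ (60 * C + 240 * R) * T + 48 * R * R := by
          simpa only [Finset.sum_add_distrib, ← Finset.mul_sum, hT, hR] using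
            Finset.sum_le_sum fun j (_ : j ∈ Finset.univ) ↦ hterm j
      _ ≤ (1 + C) * (60 * T + 240 * T * R + 48 * R ^ 2) := by
          nlinarith [mul_nonneg hC0 (mul_nonneg hT0 hR0), mul_nonneg hC0 (mul_nonneg hR0 hR0)]
  have hR4 : ‖vecR γ m S x i‖ ^ 4 = R ^ 2 := by ring
  rw [lyapunovRatio, ← mul_div_assoc, hR4]
  gcongr

lemma neg_one_pow_mul_discriminant_lt_zero_iff (hv : 0 < totalVar γ m S x i) (z : Fin p → ℝ) :
    (-1) ^ (i : ℕ) * discriminant γ π x (m i + act (CFC.sqrt (S i))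
        (∑ j, z j • (isHermitian_matB γ S x i).eigenvectorBasis j)) < 0
      ↔ (∑ j, hermiteQuadratic (quadCoeff γ S x i j) (linCoeff γ m S x i j) (z j))
          / √(totalVar γ m S x i)
        < (-1) ^ (i : ℕ) * ((xi γ π m x i - (matB γ S x i).trace) / √(totalVar γ m S x i)) := by
  have hsign : ∑ j, hermiteQuadratic (quadCoeff γ S x i j) (linCoeff γ m S x i j) (z j)
      = (-1) ^ (i : ℕ) * ∑ j, hermiteQuadratic ((isHermitian_matB γ S x i).eigenvalues j)
        (inner ℝ (vecR γ m S x i) ((isHermitian_matB γ S x i).eigenvectorBasis j)) (z j) := by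
    rw [Finset.mul_sum]
    refine Finset.sum_congr rfl fun j _ ↦ ?_
    rw [quadCoeff, linCoeff, hermiteQuadratic, hermiteQuadratic]
    ring
  rw [discriminant_add_act_sqrt, quad_add_two_mul_inner_sum_smul_eigenvectorBasis, hsign,
    ← mul_div_assoc _ _ √(totalVar γ m S x i), div_lt_div_iff_of_pos_right (Real.sqrt_pos.2 hv)]
  constructor <;> intro h <;> linarith

lemma condError_eq_measureReal_hermiteQuadratic (hv : 0 < totalVar γ m S x i) :
    condError γ π m S x i = (Measure.pi fun _ : Fin p ↦ gaussianReal 0 1).real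
      {z | (∑ j, hermiteQuadratic (quadCoeff γ S x i j) (linCoeff γ m S x i j) (z j))
          / √(totalVar γ m S x i)
        < (-1) ^ (i : ℕ) * ((xi γ π m x i - (matB γ S x i).trace) / √(totalVar γ m S x i))} := by
  have hmeas : MeasurableSet {y | (-1 : ℝ) ^ (i : ℕ) * discriminant γ π x y < 0} :=
    measurableSet_lt (by fun_prop) measurable_const
  have hact : Measurable fun z ↦ m i + act (CFC.sqrt (S i)) z := by fun_prop
  have hlaw : multivariateGaussian (m i) (S i)
      = ((Measure.pi fun _ : Fin p ↦ gaussianReal 0 1).map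
          fun z ↦ ∑ j, z j • (isHermitian_matB γ S x i).eigenvectorBasis j).map
        fun z ↦ m i + act (CFC.sqrt (S i)) z := by
    rw [← stdGaussian_eq_map_pi_orthonormalBasis]
    rfl
  rw [condError, hlaw, map_measureReal_apply hact hmeas,
    map_measureReal_apply (by fun_prop) (hact hmeas)]
  simp only [Set.preimage_ofPred_eq, neg_one_pow_mul_discriminant_lt_zero_iff π m x i hv]

end Discriminant

theorem tendstoInDistribution_sum_hermiteQuadratic_coeff {p : ℕ → ℕ} {n : ℕ → Fin 2 → ℕ} {γ : ℝ}
    (m : (k : ℕ) → Fin 2 → EuclideanSpace ℝ (Fin (p k)))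
    (S : (k : ℕ) → Fin 2 → Matrix (Fin (p k)) (Fin (p k)) ℝ)
    (x : (k : ℕ) → (i : Fin 2) → Fin (n k i) → EuclideanSpace ℝ (Fin (p k))) (i : Fin 2)
    (hγ : 0 ≤ γ) (hS : ∀ k, (S k i).PosSemidef)
    (hcov : (fun k ↦ specNorm (S k i)) =O[atTop] (fun _ ↦ (1 : ℝ)))
    (hpos : ∀ᶠ k in atTop, 0 < totalVar γ (m k) (S k) (x k) i)
    (hlyap : Tendsto (fun k ↦ lyapunovRatio γ (m k) (S k) (x k) i) atTop (𝓝 0)) :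
    TendstoInDistribution (fun k z ↦ (∑ j, hermiteQuadratic (quadCoeff γ (S k) (x k) i j)
        (linCoeff γ (m k) (S k) (x k) i j) (z j)) / √(totalVar γ (m k) (S k) (x k) i)) atTop
      id (fun k ↦ Measure.pi fun _ : Fin (p k) ↦ gaussianReal 0 1) (gaussianReal 0 1) := by
  have hbdd : (fun k ↦ 1 + specNorm (S k i) ^ 2) =O[atTop] (fun _ ↦ (1 : ℝ)) :=
    (Asymptotics.isBigO_refl _ _).add (by simpa only [one_pow] using hcov.pow 2)
  have hbound : Tendsto (fun k ↦ (1 + specNorm (S k i) ^ 2) *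
      lyapunovRatio γ (m k) (S k) (x k) i) atTop (𝓝 0) := by
    simpa only [one_mul, Asymptotics.isLittleO_one_iff] using
      hbdd.mul_isLittleO ((Asymptotics.isLittleO_one_iff ℝ).2 hlyap)
  exact tendstoInDistribution_sum_hermiteQuadratic
    (fun k ↦ totalVar_eq_sum γ (m k) (S k) (x k) i) hpos
    (squeeze_zero (fun k ↦ by positivity)
      (fun k ↦ sum_fourth_moment_div_totalVar_sq_le (m k) (x k) i hγ (hS k)) hbound)

end RQDA

theorem mainTheorem8_general {p : ℕ → ℕ} {n : ℕ → Fin 2 → ℕ} {γ : ℝ} (hγ : 0 ≤ γ)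
    (π : ℕ → Fin 2 → ℝ) (m : (k : ℕ) → Fin 2 → EuclideanSpace ℝ (Fin (p k)))
    (S : (k : ℕ) → Fin 2 → Matrix (Fin (p k)) (Fin (p k)) ℝ)
    (x : (k : ℕ) → (i : Fin 2) → Fin (n k i) → EuclideanSpace ℝ (Fin (p k))) (i : Fin 2)
    (hS : ∀ k, (S k i).PosSemidef)
    (hcov : (fun k ↦ RQDA.specNorm (S k i)) =O[atTop] (fun _ ↦ (1 : ℝ)))
    (hpos : ∀ᶠ k in atTop, 0 < RQDA.totalVar γ (m k) (S k) (x k) i)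
    (hlyap : Tendsto (fun k ↦ RQDA.lyapunovRatio γ (m k) (S k) (x k) i) atTop (𝓝 0)) :
    Tendsto (fun k ↦ RQDA.condError γ (π k) (m k) (S k) (x k) i
      - cdf (gaussianReal 0 1) ((-1 : ℝ) ^ (i : ℕ) *
        ((RQDA.xi γ (π k) (m k) (x k) i - (RQDA.matB γ (S k) (x k) i).trace)
          / √(RQDA.totalVar γ (m k) (S k) (x k) i)))) atTop (𝓝 0) := by
  have : NullSingletonClass ((gaussianReal 0 1).map id) := by
    rw [Measure.map_id]
    exact nullSingletonClass_gaussianReal one_ne_zero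
  have hcdf := tendsto_measureReal_lt_sub_cdf_map
    (RQDA.tendstoInDistribution_sum_hermiteQuadratic_coeff m S x i hγ hS hcov hpos hlyap)
    fun k ↦ (-1 : ℝ) ^ (i : ℕ) * ((RQDA.xi γ (π k) (m k) (x k) i
      - (RQDA.matB γ (S k) (x k) i).trace) / √(RQDA.totalVar γ (m k) (S k) (x k) i))
  rw [Measure.map_id] at hcdf
  refine hcdf.congr' ?_
  filter_upwards [hpos] with k hk
  rw [RQDA.condError_eq_measureReal_hermiteQuadratic (π k) (m k) (x k) i hk]

theorem mainTheorem8
    {Ω : Type*} [MeasurableSpace Ω] (P : Measure Ω) [IsProbabilityMeasure P]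
    -- dimension `p k` and class sample sizes `n k i`
    (p : ℕ → ℕ) (n : ℕ → Fin 2 → ℕ)
    -- regularization parameter and priors
    (γ : ℝ) (hγ : 0 < γ)
    (π : ℕ → Fin 2 → ℝ) (hπ_pos : ∀ k i, 0 < π k i) (hπ_sum : ∀ k, π k 0 + π k 1 = 1)
    -- class means and covariance matrices
    (m : (k : ℕ) → Fin 2 → EuclideanSpace ℝ (Fin (p k)))
    (S : (k : ℕ) → Fin 2 → Matrix (Fin (p k)) (Fin (p k)) ℝ)
    (hS : ∀ k i, (S k i).PosSemidef)
    -- training samples: for each `k`, independent, of law `N(m k i, S k i)` in class `i`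
    (X : (k : ℕ) → (i : Fin 2) → Fin (n k i) → Ω → EuclideanSpace ℝ (Fin (p k)))
    (hX_law : ∀ k i l, HasLaw (X k i l) (multivariateGaussian (m k i) (S k i)) P)
    (hX_indep : ∀ k, iIndepFun (fun a : (Σ i : Fin 2, Fin (n k i)) => X k a.1 a.2) P)
    -- growth regime
    (hp : Tendsto p atTop atTop) (hn : ∀ i, Tendsto (fun k => n k i) atTop atTop)
    (hn_diff : Tendsto (fun k => (n k 0 : ℝ) - (n k 1 : ℝ)) atTop (𝓝 0))
    (c : ℝ) (hc : 0 < c)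
    (hpn : Tendsto (fun k => (p k : ℝ) / ((n k 0 : ℝ) + (n k 1 : ℝ))) atTop (𝓝 c))
    (hmean : (fun k => ‖m k 0 - m k 1‖ ^ 2) =O[atTop] (fun k => √(p k : ℝ)))
    (hcov : ∀ i, (fun k => RQDA.specNorm (S k i)) =O[atTop] (fun _ => (1 : ℝ)))
    (heig : RQDA.EigenvalueSplit p (fun k => S k 0 - S k 1)
      (fun k => (hS k 0).isHermitian.sub (hS k 1).isHermitian))
    -- the additional condition on the (random) quantities `B_i` and `r_i`, almost surely
    (hcond : ∀ i, ∀ᵐ ω ∂P,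
      (∀ᶠ k in atTop, 0 < RQDA.totalVar γ (m k) (S k) (fun j l => X k j l ω) i) ∧
      Tendsto (fun k => RQDA.lyapunovRatio γ (m k) (S k) (fun j l => X k j l ω) i)
        atTop (𝓝 0)) :
    ∀ i : Fin 2, ∀ᵐ ω ∂P,
      Tendsto (fun k =>
        RQDA.condError γ (π k) (m k) (S k) (fun j l => X k j l ω) i
          - cdf (gaussianReal 0 1)
              ((-1 : ℝ) ^ (i : ℕ) *
                ((RQDA.xi γ (π k) (m k) (fun j l => X k j l ω) i
                    - (RQDA.matB γ (S k) (fun j l => X k j l ω) i).trace)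
                  / √(RQDA.totalVar γ (m k) (S k) (fun j l => X k j l ω) i))))
        atTop (𝓝 0) := by
  intro i
  filter_upwards [hcond i] with ω hω
  exact mainTheorem8_general hγ.le π m S (fun k j l => X k j l ω) i (fun k => hS k i) (hcov i)
    hω.1 hω.2
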